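/- Theorem. Let $V$ be a finite set of metavariables, each with a finite range, and let $D$ be the (folded) graph of a dynamic causal network with static confounders: an acyclic set of directed edges $j\to k$ inside a time slice, a set of directed edges $j\to k$ labelled $+1$ (standing for $V_{j,t}\to V_{k,t+1}$, $t\in\mathbb Z$), and a set of bidirected edges $j\leftrightarrow k$ inside a time slice; there are no bidirected edges between different slices. A causal model $M$ with graph $D$ consists of mutually independent unobserved variables (for each $t\in\mathbb Z$ one noise for every metavariable and one confounder for every bidirected edge), of mechanisms $f_{k,t}$, and of an observed process satisfying $V_{k,t}=f_{k,t}(\text{parents of }V_{k,t}\text{ in slices }t\text{ and }t-1,\ \text{noise of }k\text{ and confounders incident to }k\text{ at time }t)$ for all $k,t$, such that for each $t$ the observed past $(V_s)_{s<t}$ is independent of the unobserved variables of times $\ge t$. Under $do(X=x)$, with $X\subseteq V_{t_x}$, the equations of $X$ are replaced by $X=x$ and the modified equations are solved from time $t_x$ on, starting from the undisturbed slice $V_{t_x-1}$; slices before $t_x$ are unchanged. Let $\mathcal M$ be any class of causal models with graph $D$ (for example, all those with strictly positive observational distributions) such that $P_M(V_t=v)>0$ for all $M\in\mathcal M$, all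 $t>t_x$ and all configurations $v$ of a slice. A quantity $Q(M)$ is identifiable (in $\mathcal M$) if $Q(M)=Q(M')$ whenever $M,M'\in\mathcal M$ have the same observational distribution of all the observed variables $(V_t)_{t\in\mathbb Z}$. A conditional probability enters only where the conditioning event has positive probability. Let $t_0<t_x<t_y$ be integers, $X\subseteq V_{t_x}$, $Y\subseteq V_{t_y}$, and let $x$ be a value of $X$. If $P(V_{t_x+1}\mid V_{t_x-1},do(X=x))$ is identifiable, then $P(Y\mid do(X=x))$ is identifiable. Moreover, let $M\in\mathcal M$ have a time-invariant transition matrix $T$ from $t_0$ on, i.e. $T_{ij}=P_M(V_{t+1}=i\mid V_t=j)$ for all $t\ge t_0$, and let $A$ be the corresponding matrix, $A_{ij}=P_M(V_{t_x+1}=i\mid V_{t_x-1}=j,do(X=x))$. Then in $M$ $$P(Y\mid do(X=x))=\sum_{V_{t_y}\setminus Y}T^{\,t_y-(t_x+1)}\,A\,T^{\,t_x-1-t_0}\,P(V_{t_0}),$$ where for each value $y$ of $Y$ the sum runs over the entries of the vector indexed by the slice configurations that agree with $y$ on $Y$. -/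

import Mathlib

universe u v w

open MeasureTheory ProbabilityTheory

open scoped Classical in
/-- The matrix of conditional probabilities `P(W = i | Z = j)`; row index `i`, column index `j`.
Columns `j` with `P(Z = j) = 0`, where the conditional probability is undefined, are filled
with zeros. -/
noncomputable def condMatrix {Ω S : Type*} [MeasurableSpace Ω] (μ : Measure Ω) (Z W : Ω → S) :
    Matrix S S ℝ :=
  Matrix.of fun i j =>
    if μ (Z ⁻¹' {j}) = 0 then 0 else (ProbabilityTheory.cond μ (Z ⁻¹' {j})).real (W ⁻¹' {i})

/-- `A` is a matrix with entries `A i j = P(W = i | Z = j)`, for every column `j` for which this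
conditional probability is defined; the other columns are unconstrained. -/
def IsCondMatrix {Ω S : Type*} [MeasurableSpace Ω] (μ : Measure Ω) (Z W : Ω → S)
    (A : Matrix S S ℝ) : Prop :=
  ∀ j, μ (Z ⁻¹' {j}) ≠ 0 → ∀ i, A i j = (ProbabilityTheory.cond μ (Z ⁻¹' {j})).real (W ⁻¹' {i})

/-- The (folded) graph of a dynamic causal network with static confounders over the metavariables
`V`.  It represents the biinfinite graph over the variables `V_{k,t}`, `t : ℤ`, with
* a directed edge `V_{j,t} → V_{k,t}` for each unlabelled edge `intra j k`,
* a directed edge `V_{j,t} → V_{k,t+1}` for each edge `next j k` labelled `+1`,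
* a bidirected edge `V_{j,t} ↔ V_{k,t}` (an unobserved confounder) for each edge of `conf`;
there are no bidirected edges between different slices. -/
structure StaticDCN (V : Type*) where
  intra : V → V → Prop
  next : V → V → Prop
  conf : SimpleGraph V
  acyclic : ∀ k, ¬ Relation.TransGen intra k k

namespace StaticDCN

/-- The exogenous processes: a private noise for every metavariable and one unobserved confounder
for every bidirected edge. -/
abbrev Exo {V : Type*} (G : StaticDCN V) : Type _ := V ⊕ G.conf.edgeSet

/-- The exogenous process `e` is an argument of the mechanism of `k`: it is the noise of `k` or a
confounder sitting on a bidirected edge with endpoint `k`. -/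
def Affects {V : Type*} (G : StaticDCN V) : G.Exo → V → Prop
  | Sum.inl j, k => j = k
  | Sum.inr e, k => k ∈ e.1

theorem wellFounded_intra {V : Type*} [Finite V] (G : StaticDCN V) : WellFounded G.intra := by
  have : Std.Irrefl (Relation.TransGen G.intra) := ⟨G.acyclic⟩
  have h : WellFounded (Relation.TransGen G.intra) := Finite.wellFounded_of_trans_of_irrefl _
  exact Subrelation.wf (fun {a b} hab => Relation.TransGen.single hab) h

/-- A causal model with graph `G`, the metavariable `k` taking values in `Val k`.
The mechanism of `V_{k,t}` is a function of the parents of `V_{k,t}` in the slices `t` and `t - 1`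
and of the exogenous variables at time `t` affecting `k`. -/
structure Model {V : Type u} (G : StaticDCN V) (Val : V → Type v)
    [∀ k, MeasurableSpace (Val k)] where
  /-- ranges of the exogenous variables -/
  U : G.Exo → ℤ → Type w
  mU : ∀ e t, MeasurableSpace (U e t)
  /-- the mechanisms -/
  f : ∀ (k : V) (t : ℤ), (∀ j : {j // G.intra j k}, Val j) → (∀ j : {j // G.next j k}, Val j) →
    (∀ e : {e // G.Affects e k}, U e t) → Val k
  measurable_f : ∀ k t a b, Measurable (f k t a b)
  /-- the underlying probability space -/
  Ω : Type w
  mΩ : MeasurableSpace Ω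
  P : Measure Ω
  isProb : IsProbabilityMeasure P
  /-- the exogenous (unobserved) variables, which are mutually independent -/
  exo : ∀ (e : G.Exo) (t : ℤ), Ω → U e t
  measurable_exo : ∀ e t, Measurable (exo e t)
  indep_exo : iIndepFun (fun (p : G.Exo × ℤ) => exo p.1 p.2) P
  /-- the observed process: `obs t ω k` is the value of `V_{k,t}` -/
  obs : ℤ → Ω → ∀ k, Val k
  measurable_obs : ∀ t, Measurable (obs t)
  /-- the structural equations -/
  structural : ∀ t ω k, obs t ω k =
    f k t (fun j => obs t ω j) (fun j => obs (t - 1) ω j) (fun e => exo e t ω)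
  /-- causes precede their effects: the observed past is independent of all exogenous variables
  from time `t` on -/
  nonanticipating : ∀ t : ℤ, IndepFun (γ := ∀ p : G.Exo × Set.Ici t, U p.1 p.2)
    (fun ω (s : Set.Iio t) => obs s ω) (fun ω p => exo p.1 p.2 ω) P

attribute [instance] Model.mU Model.mΩ Model.isProb

namespace Model

/-- The observational (non-interventional) joint distribution of all the observed variables. -/
noncomputable def obsLaw {V : Type u} {G : StaticDCN V} {Val : V → Type v}
    [∀ k, MeasurableSpace (Val k)] (M : Model.{u, v, w} G Val) :
    Measure (ℤ → ∀ k, Val k) :=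
  M.P.map fun ω t => M.obs t ω

/-- The solution of the equations of slice `t`, given the previous slice `prev` and the exogenous
variables at time `t`, when the equation of each `k` with `iv k = some a` is replaced by
`V_{k,t} = a`. -/
noncomputable def solveSlice {V : Type u} [Finite V] {G : StaticDCN V} {Val : V → Type v}
    [∀ k, MeasurableSpace (Val k)] (M : Model.{u, v, w} G Val) (t : ℤ)
    (iv : ∀ k, Option (Val k)) (prev : ∀ k, Val k) (ε : ∀ e, M.U e t) : ∀ k, Val k :=
  G.wellFounded_intra.fix fun k ih =>
    (iv k).getD (M.f k t (fun j => ih j.1 j.2) (fun j => prev j) (fun e => ε e))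

/-- The intervention `do(X = x)` on a set `X` of variables of slice `tx`. -/
def intervention {V : Type u} [DecidableEq V] {Val : V → Type v} (tx : ℤ) (X : Finset V)
    (x : ∀ k : X, Val k) : ℤ → ∀ k, Option (Val k) :=
  fun t k => if h : t = tx ∧ k ∈ X then some (x ⟨k, h.2⟩) else none

/-- Slice `tx + n` of the process under the intervention `do(X = x)`: from the observed slice
`tx - 1` onwards, the modified structural equations are solved slice after slice. -/
noncomputable def doFrom {V : Type u} [Finite V] [DecidableEq V] {G : StaticDCN V}
    {Val : V → Type v} [∀ k, MeasurableSpace (Val k)] (M : Model.{u, v, w} G Val)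
    (tx : ℤ) (X : Finset V) (x : ∀ k : X, Val k) (ω : M.Ω) : ℕ → ∀ k, Val k
  | 0 => M.solveSlice tx (intervention tx X x tx) (M.obs (tx - 1) ω) (fun e => M.exo e tx ω)
  | n + 1 => M.solveSlice (tx + (n + 1 : ℕ)) (intervention tx X x (tx + (n + 1 : ℕ)))
      (doFrom M tx X x ω n) (fun e => M.exo e (tx + (n + 1 : ℕ)) ω)

/-- The observed process under the intervention `do(X = x)` on variables of slice `tx`: the
solution of the structural equations, those of `X` at time `tx` being replaced by `X = x`, which
coincides with the undisturbed process in the remote past. -/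
noncomputable def doProc {V : Type u} [Finite V] [DecidableEq V] {G : StaticDCN V}
    {Val : V → Type v} [∀ k, MeasurableSpace (Val k)] (M : Model.{u, v, w} G Val)
    (tx : ℤ) (X : Finset V) (x : ∀ k : X, Val k) (t : ℤ) (ω : M.Ω) : ∀ k, Val k :=
  if t < tx then M.obs t ω else M.doFrom tx X x ω (t - tx).toNat

/-- `P(Y_{ty} = y | do(X_{tx} = x))`, as a function of `y`. -/
noncomputable def effect {V : Type u} [Finite V] [DecidableEq V] {G : StaticDCN V}
    {Val : V → Type v} [∀ k, MeasurableSpace (Val k)] (M : Model.{u, v, w} G Val)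
    (tx : ℤ) (X : Finset V) (x : ∀ k : X, Val k) (ty : ℤ) (Y : Finset V) :
    (∀ k : Y, Val k) → ℝ :=
  fun y => M.P.real {ω | ∀ k : Y, M.doProc tx X x ty ω k = y k}

/-- The conditional effect `P(V_t | V_s, do(X_{tx} = x))`, as a matrix. -/
noncomputable def condEffect {V : Type u} [Finite V] [DecidableEq V] {G : StaticDCN V}
    {Val : V → Type v} [∀ k, MeasurableSpace (Val k)] (M : Model.{u, v, w} G Val)
    (tx : ℤ) (X : Finset V) (x : ∀ k : X, Val k) (s t : ℤ) :
    Matrix (∀ k, Val k) (∀ k, Val k) ℝ :=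
  condMatrix M.P (M.doProc tx X x s) (M.doProc tx X x t)

/-- `T` is the time-invariant transition matrix of the undisturbed process from time `t0` on. -/
def IsTransitionMatrix {V : Type u} {G : StaticDCN V} {Val : V → Type v}
    [∀ k, MeasurableSpace (Val k)] (M : Model.{u, v, w} G Val) (t0 : ℤ)
    (T : Matrix (∀ k, Val k) (∀ k, Val k) ℝ) : Prop :=
  ∀ t, t0 ≤ t → IsCondMatrix M.P (M.obs t) (M.obs (t + 1)) T

/-- The distribution vector `P(V_t)` of slice `t` of the undisturbed process. -/
noncomputable def sliceDist {V : Type u} {G : StaticDCN V} {Val : V → Type v}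
    [∀ k, MeasurableSpace (Val k)] (M : Model.{u, v, w} G Val) (t : ℤ) :
    (∀ k, Val k) → ℝ :=
  fun s => M.P.real (M.obs t ⁻¹' {s})

end Model

/-- The quantity `Q` is identifiable in the class `𝓜` of causal models with graph `G`: it is
uniquely determined by the observational distribution. -/
def Identifiable {V : Type u} {G : StaticDCN V} {Val : V → Type v}
    [∀ k, MeasurableSpace (Val k)] {α : Type*} (𝓜 : Set (Model.{u, v, w} G Val))
    (Q : Model.{u, v, w} G Val → α) : Prop :=
  ∀ M ∈ 𝓜, ∀ M' ∈ 𝓜, M.obsLaw = M'.obsLaw → Q M = Q M'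

end StaticDCN

/-! After slice `tx` the disturbed process obeys the original equations, driven at each step by
noise independent of its current state. Hence its law evolves by the same stochastic matrices
`sliceKernel` as the observed process (`doDist_succ`). Where the observed slice has full support,
this matrix is the observed transition matrix (`eq_sliceKernel_of_isCondMatrix`); without
positivity, the intervention could reach states whose column the observations leave undetermined.
The recursion starts from `doDist_one`: the law at `tx + 1` is `A` applied to the undisturbed law at
`tx - 1`. Both claims follow by induction over slices: each ingredient is determined by `obsLaw` or
identifiable by hypothesis, and in the time-invariant case every observed transition is `T`. -/

section FiniteConditioning

/-! ### Conditional probability matrices on a finite state space. -/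

variable {Ω S : Type*} [MeasurableSpace Ω]

theorem isCondMatrix_condMatrix (μ : Measure Ω) (Z W : Ω → S) :
    IsCondMatrix μ Z W (condMatrix μ Z W) := fun j hj i => by
  simp [condMatrix, hj]

variable [MeasurableSpace S]

theorem sum_real_preimage_singleton_inter [Fintype S] [MeasurableSingletonClass S]
    {μ : Measure Ω} [IsFiniteMeasure μ] {Z : Ω → S} (hZ : Measurable Z) (B : Set Ω) :
    ∑ j, μ.real (Z ⁻¹' {j} ∩ B) = μ.real B := by
  classical
  have h := sum_measureReal_preimage_singleton (μ := μ.restrict B) (f := Z) Finset.univ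
    (fun j _ => hZ (measurableSet_singleton j))
  simp only [Finset.coe_univ, Set.preimage_univ, measureReal_restrict_apply_univ] at h
  rw [← h]
  exact Finset.sum_congr rfl fun j _ =>
    (measureReal_restrict_apply (hZ (measurableSet_singleton j))).symm

/-- On a null column both sides vanish, so the unconstrained entries of `A` never matter. -/
theorem IsCondMatrix.mul_real [MeasurableSingletonClass S] {μ : Measure Ω} [IsFiniteMeasure μ]
    {Z W : Ω → S} {A : Matrix S S ℝ} (hA : IsCondMatrix μ Z W A) (hZ : Measurable Z) (i j : S) :
    A i j * μ.real (Z ⁻¹' {j}) = μ.real (Z ⁻¹' {j} ∩ W ⁻¹' {i}) := by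
  by_cases hj : μ (Z ⁻¹' {j}) = 0
  · have h1 : μ.real (Z ⁻¹' {j}) = 0 := by simp [measureReal_def, hj]
    have h2 : μ.real (Z ⁻¹' {j} ∩ W ⁻¹' {i}) = 0 := by
      simp [measureReal_def, measure_mono_null Set.inter_subset_left hj]
    rw [h1, h2, mul_zero]
  · have h1 : μ.real (Z ⁻¹' {j}) ≠ 0 := by
      simpa [measureReal_def, ENNReal.toReal_eq_zero_iff] using hj
    rw [hA j hj i, measureReal_def (cond _ _),
      cond_apply (hZ (measurableSet_singleton j)), ENNReal.toReal_mul, ENNReal.toReal_inv,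
      ← measureReal_def, ← measureReal_def]
    field_simp

theorem IsCondMatrix.mulVec_real [Fintype S] [MeasurableSingletonClass S] {μ : Measure Ω}
    [IsFiniteMeasure μ] {Z W : Ω → S} {A : Matrix S S ℝ} (hA : IsCondMatrix μ Z W A)
    (hZ : Measurable Z) :
    A.mulVec (fun j => μ.real (Z ⁻¹' {j})) = fun i => μ.real (W ⁻¹' {i}) := by
  funext i
  simp only [Matrix.mulVec, dotProduct, hA.mul_real hZ]
  exact sum_real_preimage_singleton_inter hZ _

theorem condMatrix_map [MeasurableSingletonClass S] {Ω' : Type*} [MeasurableSpace Ω']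
    {μ : Measure Ω} {g : Ω → Ω'} (hg : Measurable g) {Z W : Ω' → S} (hZ : Measurable Z)
    (hW : Measurable W) :
    condMatrix (μ.map g) Z W = condMatrix μ (Z ∘ g) (W ∘ g) := by
  have hm : ∀ j, MeasurableSet (Z ⁻¹' {j}) := fun j => hZ (measurableSet_singleton j)
  have hm' : ∀ j, MeasurableSet (W ⁻¹' {j}) := fun j => hW (measurableSet_singleton j)
  ext i j
  simp only [condMatrix, Matrix.of_apply, Measure.map_apply hg (hm j), Set.preimage_comp,
    measureReal_def]
  rw [cond_apply (hm j), cond_apply (hg (hm j)), Measure.map_apply hg (hm j),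
    Measure.map_apply hg ((hm j).inter (hm' i)), Set.preimage_inter]

end FiniteConditioning

theorem ProbabilityTheory.IndepFun.prodMk_left_of_prodMk_right {Ω α β γ : Type*}
    [MeasurableSpace Ω] [MeasurableSpace α] [MeasurableSpace β] [MeasurableSpace γ]
    {μ : Measure Ω} [IsProbabilityMeasure μ] {f : Ω → α} {g : Ω → β} {h : Ω → γ}
    (hf : Measurable f) (hg : Measurable g) (hh : Measurable h)
    (hfgh : IndepFun f (fun ω => (g ω, h ω)) μ) (hgh : IndepFun g h μ) :
    IndepFun (fun ω => (f ω, g ω)) h μ := by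
  have hfg : IndepFun f g μ := hfgh.comp measurable_id measurable_fst
  rw [indepFun_iff_map_prod_eq_prod_map_map (by fun_prop) (by fun_prop)] at hfgh hgh hfg ⊢
  have : IsProbabilityMeasure (μ.map f) := Measure.isProbabilityMeasure_map hf.aemeasurable
  have : IsProbabilityMeasure (μ.map g) := Measure.isProbabilityMeasure_map hg.aemeasurable
  have : IsProbabilityMeasure (μ.map h) := Measure.isProbabilityMeasure_map hh.aemeasurable
  -- After reassociation both sides become the product of the three marginals.
  apply (MeasurableEquiv.prodAssoc (α := α) (β := β) (γ := γ)).map_measurableEquiv_injective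
  rw [hfg, Measure.prodAssoc_prod, ← hgh, ← hfgh,
    Measure.map_map (MeasurableEquiv.measurable _) (by fun_prop)]
  rfl

namespace StaticDCN

namespace Model

/-! ### Solving a slice, and independence of its noise from the past. -/

variable {V : Type u} {G : StaticDCN V} {Val : V → Type v} [∀ k, MeasurableSpace (Val k)]

theorem solveSlice_apply [Finite V] (M : Model.{u, v, w} G Val) (t : ℤ)
    (iv : ∀ k, Option (Val k)) (prev : ∀ k, Val k) (ε : ∀ e, M.U e t) (k : V) :
    M.solveSlice t iv prev ε k = (iv k).getD
      (M.f k t (fun j => M.solveSlice t iv prev ε j) (fun j => prev j) (fun e => ε e)) :=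
  WellFounded.fix_eq ..

theorem obs_eq_solveSlice [Finite V] (M : Model.{u, v, w} G Val) (t : ℤ) (ω : M.Ω) :
    M.obs t ω = M.solveSlice t (fun _ => none) (M.obs (t - 1) ω) (fun e => M.exo e t ω) := by
  funext k
  induction k using G.wellFounded_intra.induction with
  | _ k ih =>
    rw [M.structural, solveSlice_apply, Option.getD_none]
    congr 1
    funext j
    exact ih j j.2

theorem measurable_solveSlice [Finite V] [∀ k, Finite (Val k)]
    [∀ k, DiscreteMeasurableSpace (Val k)] (M : Model.{u, v, w} G Val) (t : ℤ)
    (iv : ∀ k, Option (Val k)) {α : Type*} [MeasurableSpace α] {prev : α → ∀ k, Val k}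
    (hprev : Measurable prev) {ε : α → ∀ e, M.U e t} (hε : Measurable ε) :
    Measurable fun a => M.solveSlice t iv (prev a) (ε a) := by
  refine measurable_pi_lambda _ fun k => ?_
  induction k using G.wellFounded_intra.induction with
  | _ k ih =>
    simp only [solveSlice_apply M t iv _ _ k]
    cases iv k with
    | some c => exact measurable_const
    | none =>
      simp only [Option.getD_none]
      have hf : Measurable fun q : ((∀ j : {j // G.intra j k}, Val j) ×
          (∀ j : {j // G.next j k}, Val j)) × (∀ e : {e // G.Affects e k}, M.U e t) =>
          M.f k t q.1.1 q.1.2 q.2 :=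
        -- Measurability in the noise for fixed parents suffices, since the parents take finitely
        -- many values.
        measurable_from_prod_countable_right fun q => M.measurable_f k t q.1 q.2
      refine hf.comp (.prodMk (.prodMk ?_ ?_) ?_)
      · exact measurable_pi_lambda _ fun j => ih j j.2
      · exact measurable_pi_lambda _ fun j => (measurable_pi_apply _).comp hprev
      · exact measurable_pi_lambda _ fun e => (measurable_pi_apply _).comp hε

theorem measurable_exo_slice (M : Model.{u, v, w} G Val) (t : ℤ) :
    Measurable fun ω e => M.exo e t ω :=
  measurable_pi_lambda _ fun e => M.measurable_exo e t

/-- The exogenous variables of the slices `s, …, t - 1`. -/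
def exoBetween (M : Model.{u, v, w} G Val) (s t : ℤ) (ω : M.Ω) :
    ∀ p : G.Exo × Set.Ico s t, M.U p.1 p.2 :=
  fun p => M.exo p.1 p.2 ω

theorem measurable_exoBetween (M : Model.{u, v, w} G Val) (s t : ℤ) :
    Measurable (M.exoBetween s t) :=
  measurable_pi_lambda _ fun p => M.measurable_exo p.1 p.2

theorem indepFun_exoBetween_exo [Finite V] (M : Model.{u, v, w} G Val) (s t : ℤ) :
    IndepFun (M.exoBetween s t) (fun ω e => M.exo e t ω) M.P := by
  classical
  have := Fintype.ofFinite G.Exo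
  have h := M.indep_exo.indepFun_finset (Finset.univ ×ˢ Finset.Ico s t) (Finset.univ ×ˢ {t})
    (Finset.disjoint_left.2 fun p hp hp' => by
      simp only [Finset.mem_product, Finset.mem_Ico, Finset.mem_singleton] at hp hp'
      omega)
    (fun p => M.measurable_exo p.1 p.2)
  refine h.comp
    (φ := fun g (p : G.Exo × Set.Ico s t) => g ⟨(p.1, p.2), Finset.mem_product.2 ⟨Finset.mem_univ _, Finset.mem_Ico.2 p.2.2⟩⟩)
    (ψ := fun g (e : G.Exo) => g ⟨(e, t), by simp⟩) ?_ ?_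
  · exact measurable_pi_lambda _ fun p => measurable_pi_apply _
  · exact measurable_pi_lambda _ fun p => measurable_pi_apply _

/-- `nonanticipating` at time `s` separates slice `s - 1` from all later noise; mutual independence
separates the noise before `t` from that at `t`. -/
theorem indepFun_obs_exoBetween_exo [Finite V] (M : Model.{u, v, w} G Val) {s t : ℤ}
    (hst : s ≤ t) :
    IndepFun (fun ω => (M.obs (s - 1) ω, M.exoBetween s t ω)) (fun ω e => M.exo e t ω) M.P := by
  refine IndepFun.prodMk_left_of_prodMk_right (M.measurable_obs _) (M.measurable_exoBetween s t)
    (M.measurable_exo_slice t) ?_ (M.indepFun_exoBetween_exo s t)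
  refine (M.nonanticipating s).comp
    (φ := fun g : Set.Iio s → ∀ k, Val k => g ⟨s - 1, by simp⟩)
    (ψ := fun g => ((fun p : G.Exo × Set.Ico s t => g (p.1, ⟨p.2, p.2.2.1⟩)),
      fun e : G.Exo => g (e, ⟨t, hst⟩))) (measurable_pi_apply (⟨s - 1, by simp⟩ : Set.Iio s)) (.prodMk ?_ ?_)
  · exact measurable_pi_lambda _ fun p => measurable_pi_apply _
  · exact measurable_pi_lambda _ fun p => measurable_pi_apply _

theorem indepFun_obs_exo [Finite V] (M : Model.{u, v, w} G Val) (t : ℤ) :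
    IndepFun (M.obs (t - 1)) (fun ω e => M.exo e t ω) M.P :=
  (M.indepFun_obs_exoBetween_exo le_rfl).comp measurable_fst measurable_id

/-! ### The mechanism of a slice as a stochastic matrix. -/

section Kernel

variable [Fintype V] [∀ k, Fintype (Val k)] [∀ k, DiscreteMeasurableSpace (Val k)]

/-- The mechanism of slice `t` as a stochastic matrix: the probability that the equations of the
slice produce `i` from the previous slice `j`. -/
noncomputable def sliceKernel (M : Model.{u, v, w} G Val) (t : ℤ) :
    Matrix (∀ k, Val k) (∀ k, Val k) ℝ :=
  Matrix.of fun i j =>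
    M.P.real ((fun ω => M.solveSlice t (fun _ => none) j fun e => M.exo e t ω) ⁻¹' {i})

theorem sliceKernel_mul_real (M : Model.{u, v, w} G Val) (t : ℤ) {Z : M.Ω → ∀ k, Val k}
    (hind : IndepFun Z (fun ω e => M.exo e t ω) M.P) (i j : ∀ k, Val k) :
    M.sliceKernel t i j * M.P.real (Z ⁻¹' {j}) = M.P.real (Z ⁻¹' {j} ∩
      (fun ω => M.solveSlice t (fun _ => none) (Z ω) fun e => M.exo e t ω) ⁻¹' {i}) := by
  have hm : Measurable fun ε : ∀ e, M.U e t => M.solveSlice t (fun _ => none) j ε :=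
    M.measurable_solveSlice t _ measurable_const measurable_id
  have h := hind.measure_inter_preimage_eq_mul {j}
    ((fun ε : ∀ e, M.U e t => M.solveSlice t (fun _ => none) j ε) ⁻¹' {i})
    (measurableSet_singleton _) (hm (measurableSet_singleton i))
  -- On the event `Z = j` the previous slice may be frozen at `j`; the other event then depends on
  -- the noise alone.
  have hset : Z ⁻¹' {j} ∩
      (fun ω => M.solveSlice t (fun _ => none) (Z ω) fun e => M.exo e t ω) ⁻¹' {i} =
      Z ⁻¹' {j} ∩ (fun ω e => M.exo e t ω) ⁻¹'
        ((fun ε : ∀ e, M.U e t => M.solveSlice t (fun _ => none) j ε) ⁻¹' {i}) := by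
    ext ω
    simp +contextual
  rw [hset, measureReal_def _ (_ ∩ _), h, ENNReal.toReal_mul, mul_comm]
  rfl

theorem eq_sliceKernel_of_isCondMatrix (M : Model.{u, v, w} G Val) {t : ℤ}
    (hpos : ∀ s, 0 < M.sliceDist t s) {A : Matrix (∀ k, Val k) (∀ k, Val k) ℝ}
    (hA : IsCondMatrix M.P (M.obs t) (M.obs (t + 1)) A) : A = M.sliceKernel (t + 1) := by
  have hind := M.indepFun_obs_exo (t + 1)
  have hobs := M.obs_eq_solveSlice (t + 1)
  rw [add_sub_cancel_right] at hind hobs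
  ext i j
  refine mul_right_cancel₀ (hpos j).ne' ?_
  refine (hA.mul_real (M.measurable_obs t) i j).trans ?_
  refine Eq.trans ?_ (M.sliceKernel_mul_real (t + 1) hind i j).symm
  simp only [← hobs]

variable [DecidableEq V]

theorem sliceKernel_mulVec_real (M : Model.{u, v, w} G Val) (t : ℤ) {Z : M.Ω → ∀ k, Val k}
    (hZ : Measurable Z) (hind : IndepFun Z (fun ω e => M.exo e t ω) M.P) :
    (M.sliceKernel t).mulVec (fun j => M.P.real (Z ⁻¹' {j})) = fun i => M.P.real
      ((fun ω => M.solveSlice t (fun _ => none) (Z ω) fun e => M.exo e t ω) ⁻¹' {i}) := by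
  funext i
  simp only [Matrix.mulVec, dotProduct, M.sliceKernel_mul_real t hind]
  exact sum_real_preimage_singleton_inter hZ _

end Kernel

/-! ### Quantities read off the observational law. -/

section Law

variable (M : Model.{u, v, w} G Val)

theorem measurable_obs_process : Measurable fun ω t => M.obs t ω :=
  measurable_pi_lambda _ M.measurable_obs

variable [Finite V] [∀ k, Finite (Val k)] [∀ k, DiscreteMeasurableSpace (Val k)]

theorem condMatrix_obs (s t : ℤ) :
    condMatrix M.P (M.obs s) (M.obs t) = condMatrix M.obsLaw (· s) (· t) :=
  (condMatrix_map M.measurable_obs_process (measurable_pi_apply s) (measurable_pi_apply t)).symm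

theorem sliceDist_eq (t : ℤ) : M.sliceDist t = fun s => M.obsLaw.real ((· t) ⁻¹' {s}) := by
  funext s
  rw [obsLaw, map_measureReal_apply M.measurable_obs_process
    (measurable_pi_apply t (measurableSet_singleton s))]
  rfl

end Law

/-- Total probability alone gives this, so no positivity is needed before the intervention. -/
theorem IsTransitionMatrix.sliceDist_eq_pow_mulVec [Fintype V] [DecidableEq V] [∀ k, Fintype (Val k)]
    [∀ k, DiscreteMeasurableSpace (Val k)] [DecidableEq (∀ k, Val k)]
    {M : Model.{u, v, w} G Val} {t0 : ℤ} {T : Matrix (∀ k, Val k) (∀ k, Val k) ℝ}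
    (hT : M.IsTransitionMatrix t0 T) (n : ℕ) :
    M.sliceDist (t0 + n) = (T ^ n).mulVec (M.sliceDist t0) := by
  induction n with
  | zero => simp
  | succ n ih =>
    rw [pow_succ', ← Matrix.mulVec_mulVec, ← ih, Nat.cast_succ, ← add_assoc]
    exact ((hT _ (by omega)).mulVec_real (M.measurable_obs _)).symm

/-! ### The process under intervention. -/

section Intervention

variable [DecidableEq V] [Fintype V] (M : Model.{u, v, w} G Val) (tx : ℤ) (X : Finset V) (x : ∀ k : X, Val k)

theorem doFrom_succ (ω : M.Ω) (n : ℕ) :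
    M.doFrom tx X x ω (n + 1) = M.solveSlice (tx + n + 1) (fun _ => none)
      (M.doFrom tx X x ω n) (fun e => M.exo e (tx + n + 1) ω) := by
  have h : intervention (Val := Val) tx X x (tx + (n + 1 : ℕ)) = fun _ => none := by
    funext k
    exact dif_neg fun h => by omega
  rw [doFrom, h, Nat.cast_succ, ← add_assoc]

theorem doProc_sub_one : M.doProc tx X x (tx - 1) = M.obs (tx - 1) := by
  funext ω
  exact if_pos (by omega)

theorem doProc_add (n : ℕ) : M.doProc tx X x (tx + n) = fun ω => M.doFrom tx X x ω n := by
  funext ω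
  rw [doProc, if_neg (by omega), add_sub_cancel_left, Int.toNat_natCast]

variable [∀ k, Fintype (Val k)] [∀ k, DiscreteMeasurableSpace (Val k)]

/-- Slice `tx + n` uses no noise later than its own time, which yields its independence from the
noise at `tx + n + 1`. -/
theorem exists_measurable_doFrom (n : ℕ) :
    ∃ F : (∀ k, Val k) × (∀ p : G.Exo × Set.Ico tx (tx + n + 1), M.U p.1 p.2) → ∀ k, Val k,
      Measurable F ∧
        ∀ ω, M.doFrom tx X x ω n = F (M.obs (tx - 1) ω, M.exoBetween tx (tx + n + 1) ω) := by
  induction n with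
  | zero =>
    refine ⟨fun q => M.solveSlice tx (intervention tx X x tx) q.1
      (fun e => q.2 (e, ⟨tx, by simp⟩)), ?_, fun ω => rfl⟩
    exact M.measurable_solveSlice tx _ measurable_fst
      (measurable_pi_lambda _ fun e => (measurable_pi_apply _).comp measurable_snd)
  | succ n ih =>
    obtain ⟨F, hF, hF'⟩ := ih
    refine ⟨fun q => M.solveSlice (tx + n + 1) (fun _ => none)
      (F (q.1, fun p => q.2 (p.1, ⟨p.2, p.2.2.1, by have := p.2.2.2; push_cast; omega⟩)))
      (fun e => q.2 (e, ⟨tx + n + 1, by omega, by push_cast; omega⟩)), ?_, fun ω => ?_⟩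
    · refine M.measurable_solveSlice _ _ (hF.comp (measurable_fst.prodMk ?_)) ?_
      · exact measurable_pi_lambda _ fun p => (measurable_pi_apply _).comp measurable_snd
      · exact measurable_pi_lambda _ fun p => (measurable_pi_apply _).comp measurable_snd
    · rw [doFrom_succ, hF']
      rfl

theorem measurable_doFrom (n : ℕ) : Measurable fun ω => M.doFrom tx X x ω n := by
  obtain ⟨F, hF, hF'⟩ := M.exists_measurable_doFrom tx X x n
  simp only [hF']
  exact hF.comp ((M.measurable_obs _).prodMk (M.measurable_exoBetween _ _))

theorem indepFun_doFrom_exo (n : ℕ) :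
    IndepFun (fun ω => M.doFrom tx X x ω n) (fun ω e => M.exo e (tx + n + 1) ω) M.P := by
  obtain ⟨F, hF, hF'⟩ := M.exists_measurable_doFrom tx X x n
  simp only [hF']
  exact (M.indepFun_obs_exoBetween_exo (by omega)).comp hF measurable_id

/-- The distribution vector of slice `tx + n` under the intervention `do(X = x)`. -/
noncomputable def doDist (n : ℕ) : (∀ k, Val k) → ℝ :=
  fun s => M.P.real ((fun ω => M.doFrom tx X x ω n) ⁻¹' {s})

theorem doDist_succ (n : ℕ) :
    M.doDist tx X x (n + 1) = (M.sliceKernel (tx + n + 1)).mulVec (M.doDist tx X x n) := by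
  refine Eq.trans ?_ (M.sliceKernel_mulVec_real (tx + n + 1) (M.measurable_doFrom tx X x n)
    (M.indepFun_doFrom_exo tx X x n)).symm
  simp only [← doFrom_succ]
  rfl

/-- `A` jumps over slice `tx`, so the altered mechanism need not be computed. -/
theorem doDist_one {A : Matrix (∀ k, Val k) (∀ k, Val k) ℝ}
    (hA : IsCondMatrix M.P (M.doProc tx X x (tx - 1)) (M.doProc tx X x (tx + 1)) A) :
    M.doDist tx X x 1 = A.mulVec (M.sliceDist (tx - 1)) := by
  have h1 := M.doProc_add tx X x 1
  rw [Nat.cast_one] at h1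
  rw [doProc_sub_one, h1] at hA
  exact (hA.mulVec_real (M.measurable_obs _)).symm

theorem effect_eq_sum_doDist [∀ k, DecidableEq (Val k)] (n : ℕ) (Y : Finset V)
    (y : ∀ k : Y, Val k) :
    M.effect tx X x (tx + n) Y y =
      ∑ s : ∀ k, Val k with ∀ k : Y, s k = y k, M.doDist tx X x n s := by
  rw [effect, doProc_add]
  refine Eq.trans ?_ (sum_measureReal_preimage_singleton _ fun s _ =>
    M.measurable_doFrom tx X x n (measurableSet_singleton s)).symm
  congr 1
  ext ω
  simp

end Intervention

end Model

end StaticDCN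

theorem mainTheorem7 {V : Type u} [Fintype V] [DecidableEq V] {Val : V → Type v}
    [∀ k, Fintype (Val k)] [∀ k, DecidableEq (Val k)]
    [∀ k, MeasurableSpace (Val k)] [∀ k, DiscreteMeasurableSpace (Val k)]
    (D : StaticDCN V)
    (t0 tx ty : ℤ) (h0 : t0 < tx) (hxy : tx < ty)
    (X Y : Finset V) (x : ∀ k : X, Val k)
    -- the class of causal models under consideration; strict positivity after `tx`
    (𝓜 : Set (StaticDCN.Model.{u, v, w} D Val))
    (hpos : ∀ M ∈ 𝓜, ∀ t, tx < t → ∀ s, 0 < M.sliceDist t s)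
    (hid : StaticDCN.Identifiable 𝓜 (fun M => M.condEffect tx X x (tx - 1) (tx + 1))) :
    StaticDCN.Identifiable 𝓜 (fun M => M.effect tx X x ty Y) ∧
    ∀ M ∈ 𝓜, ∀ T A : Matrix (∀ k, Val k) (∀ k, Val k) ℝ,
      M.IsTransitionMatrix t0 T →
      IsCondMatrix M.P (M.doProc tx X x (tx - 1)) (M.doProc tx X x (tx + 1)) A →
      ∀ y : ∀ k : Y, Val k,
        M.effect tx X x ty Y y =
          ∑ s : ∀ k, Val k with ∀ k : Y, s k = y k,
            Matrix.mulVec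
              (T ^ (ty - (tx + 1)).toNat * A * T ^ (tx - 1 - t0).toNat) (M.sliceDist t0) s := by
  -- The conditioning slice `tx + n + 1` lies strictly after `tx`, where positivity holds.
  have hstep : ∀ M ∈ 𝓜, ∀ n : ℕ, ∀ B : Matrix (∀ k, Val k) (∀ k, Val k) ℝ,
      IsCondMatrix M.P (M.obs (tx + (n + 1 : ℕ))) (M.obs (tx + (n + 1 : ℕ) + 1)) B →
      M.doDist tx X x (n + 2) = B.mulVec (M.doDist tx X x (n + 1)) := by
    intro M hM n B hB
    rw [M.doDist_succ, ← M.eq_sliceKernel_of_isCondMatrix (hpos M hM _ (by omega)) hB]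
  obtain ⟨m, rfl⟩ : ∃ m : ℕ, ty = tx + (m + 1 : ℕ) := ⟨(ty - (tx + 1)).toNat, by omega⟩
  refine ⟨fun M hM M' hM' hlaw => ?_, fun M hM T A hT hA y => ?_⟩
  · have hdist : ∀ n : ℕ, M.doDist tx X x (n + 1) = M'.doDist tx X x (n + 1) := by
      intro n
      induction n with
      | zero =>
        rw [M.doDist_one tx X x (isCondMatrix_condMatrix _ _ _),
          M'.doDist_one tx X x (isCondMatrix_condMatrix _ _ _), M.sliceDist_eq, M'.sliceDist_eq,
          hlaw]
        -- The one place where the identifiability hypothesis enters.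
        exact congrArg (Matrix.mulVec · _) (hid M hM M' hM' hlaw)
      | succ n ih =>
        rw [hstep M hM n _ (isCondMatrix_condMatrix _ _ _),
          hstep M' hM' n _ (isCondMatrix_condMatrix _ _ _), ih, M.condMatrix_obs, M'.condMatrix_obs,
          hlaw]
    funext y
    simp only [StaticDCN.Model.effect_eq_sum_doDist, hdist]
  · have hdist : ∀ n : ℕ, M.doDist tx X x (n + 1) =
        (T ^ n * A * T ^ (tx - 1 - t0).toNat).mulVec (M.sliceDist t0) := by
      intro n
      induction n with
      | zero =>
        rw [M.doDist_one tx X x hA, pow_zero, one_mul, ← Matrix.mulVec_mulVec,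
          ← hT.sliceDist_eq_pow_mulVec]
        congr 2
        omega
      | succ n ih =>
        rw [hstep M hM n T (hT _ (by omega)), ih, Matrix.mulVec_mulVec, pow_succ', mul_assoc,
          mul_assoc, mul_assoc]
    rw [M.effect_eq_sum_doDist, show (tx + ((m + 1 : ℕ) : ℤ) - (tx + 1)).toNat = m by omega,
      hdist]
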